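/- Let $m,n\in\mathbb{Z}$ be square-free with $m\equiv 3 \pmod 4$ and $n\equiv 2 \pmod 4$, let $L=\mathbb{Q}(\sqrt m,\sqrt n)$ with ring of integers $\mathcal{O}_L$, and put $k=mn/\gcd(m,n)^2$. A Hopf-Galois structure on $L/\mathbb{Q}$ is a finite-dimensional cocommutative $\mathbb{Q}$-Hopf algebra $H$ together with a $\mathbb{Q}$-linear action of $H$ on $L$ that makes $L$ a left $H$-module algebra and for which the map $L\otimes_{\mathbb{Q}}H\to\mathrm{End}_{\mathbb{Q}}(L)$, $x\otimes h\mapsto\bigl(y\mapsto x\,(h\cdot y)\bigr)$, is bijective. Its associated order is $\mathfrak{A}_H=\{h\in H \mid h\cdot\mathcal{O}_L\subseteq\mathcal{O}_L\}$. If $n=\pm2$ or $k=\pm2$, then for every Hopf-Galois structure $H$ on $L/\mathbb{Q}$ the ring of integers $\mathcal{O}_L$ is a free $\mathfrak{A}_H$-module. -/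

import Mathlib

open scoped TensorProduct NumberField

/-- A Hopf-Galois structure on a field extension `L/K` with underlying `K`-Hopf algebra `H`:
`H` is finite-dimensional and cocommutative, and it acts `K`-linearly on `L` (through a
homomorphism of `K`-algebras `act : H → End_K(L)`, written `h · x = act h x`) in such a way that
`L` is a left `H`-module algebra and `j : L ⊗ H → End_K(L)`, `j(x ⊗ h)(y) = x (h · y)`,
is bijective. -/
structure HopfGaloisStructure (K L H : Type*) [Field K] [Field L] [Algebra K L]
    [Ring H] [HopfAlgebra K H] where
  /-- the action of `H` on `L` -/
  act : H →ₐ[K] Module.End K L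
  finite : Module.Finite K H
  cocomm : Coalgebra.IsCocomm K H
  /-- `h · 1 = ε(h) 1` -/
  act_one : ∀ h : H, act h 1 = algebraMap K L (Coalgebra.counit (R := K) h)
  /-- `h · (x y) = ∑ (h₁ · x) (h₂ · y)` where `Δ(h) = ∑ h₁ ⊗ h₂` -/
  act_mul : ∀ (h : H) (x y : L), act h (x * y) =
    LinearMap.mul' K L
      (TensorProduct.map (act.toLinearMap.flip x) (act.toLinearMap.flip y)
        (Coalgebra.comul (R := K) h))
  /-- `x ⊗ h ↦ (y ↦ x (h · y))` is bijective -/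
  bijective : Function.Bijective
    (TensorProduct.lift
      ((LinearMap.mul K (Module.End K L)).compl₁₂ (Algebra.lmul K L).toLinearMap
        act.toLinearMap) : L ⊗[K] H →ₗ[K] Module.End K L)

namespace HopfGaloisStructure

variable {K L H : Type*} [Field K] [Field L] [Algebra K L] [Ring H] [HopfAlgebra K H]

/-- The map `j` of the definition is `j(x ⊗ h)(y) = x (h · y)`. -/
theorem lift_tmul_apply (S : HopfGaloisStructure K L H) (x : L) (h : H) (y : L) :
    (TensorProduct.lift
      ((LinearMap.mul K (Module.End K L)).compl₁₂ (Algebra.lmul K L).toLinearMap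
        S.act.toLinearMap) : L ⊗[K] H →ₗ[K] Module.End K L) (x ⊗ₜ h) y = x * S.act h y := by
  simp

/-- The associated order of the ring of integers of `L` in `H`:
all `h ∈ H` with `h · 𝓞 L ⊆ 𝓞 L`. -/
def associatedOrder (S : HopfGaloisStructure K L H) : Subring H where
  carrier := {h | ∀ x : L, IsIntegral ℤ x → IsIntegral ℤ (S.act h x)}
  mul_mem' := by
    intro a b ha hb x hx
    simpa using ha _ (hb x hx)
  one_mem' := by
    intro x hx
    simpa using hx
  add_mem' := by
    intro a b ha hb x hx
    simpa using (ha x hx).add (hb x hx)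
  zero_mem' := by
    intro x _
    simpa using (isIntegral_zero : IsIntegral ℤ (0 : L))
  neg_mem' := by
    intro a ha x hx
    simpa using (ha x hx).neg

/-- The ring of integers of `L` as a module over the associated order,
with the action of `H` on `L` restricted to both. -/
noncomputable instance moduleAssociatedOrder (S : HopfGaloisStructure K L H) :
    Module S.associatedOrder (𝓞 L) where
  smul h x := ⟨S.act (h : H) (x : L), h.2 _ x.2⟩
  one_smul x := Subtype.ext (by change S.act 1 (x : L) = x; simp)
  mul_smul a b x := Subtype.ext (by
    change S.act ((a : H) * (b : H)) (x : L) = S.act (a : H) (S.act (b : H) (x : L)); simp)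
  smul_zero a := Subtype.ext (by change S.act (a : H) (0 : L) = 0; simp)
  smul_add a x y := Subtype.ext (by
    change S.act (a : H) ((x : L) + (y : L)) = S.act (a : H) (x : L) + S.act (a : H) (y : L)
    simp)
  add_smul a b x := Subtype.ext (by
    change S.act ((a : H) + (b : H)) (x : L) = S.act (a : H) (x : L) + S.act (b : H) (x : L)
    simp)
  zero_smul x := Subtype.ext (by change S.act 0 (x : L) = 0; simp)

theorem coe_smul (S : HopfGaloisStructure K L H) (h : S.associatedOrder) (x : 𝓞 L) :
    ((h • x : 𝓞 L) : L) = S.act (h : H) (x : L) := rfl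

end HopfGaloisStructure

/-! ### Dedekind independence: the Galois group as an `L`-basis of `End_K(L)`. -/

section GaloisEnd

variable {K L : Type*} [Field K] [Field L] [Algebra K L]

/-! By Dedekind independence every `h` in `H` acts as `∑ c_σ(h) σ` with unique coefficients in `L`.
The module-algebra axiom makes the `c_σ` orthogonal idempotents of `Hom_K(H, L)` under convolution,
and bijectivity of `j` makes them an `L`-basis. The Galois group, acting on values, therefore
permutes them (`twist`), and descent shows that every family of coefficients equivariant for this
permutation comes from `H` (`exists_coeff_eq`). This is the part of Greither–Pareigis theory needed
here.

For a Klein four-group, `twist` fixes `1`, so it is trivial or swaps two elements. Closure of `H`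
under multiplication then allows only a swap of `p` and `p * r` whose kernel is generated by `r`
(`twist_eq_or`). This leaves the group algebra and one type for each of the three involutions `r`
(`exists_act`).

When `n = ±2` the integers have basis `1, √m, √n, (√n + √m√n)/2`. For each type there is an integral
`α` such that every integral `x` equals `h · α` for an explicit `h` preserving `𝓞 L`; a dimension
count makes `α` a free generator (`free_of_exists_act_eq`). If `k = ±2`, then `n = m k`, and `√k`
can replace `√n`. -/

theorem linearIndependent_algEquiv_toLinearMap :
    LinearIndependent L (fun σ : L ≃ₐ[K] L => (σ.toLinearMap : L →ₗ[K] L)) :=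
  (linearIndependent_toLinearMap K L L).comp (fun σ : L ≃ₐ[K] L => (σ : L →ₐ[K] L))
    (fun _ _ h => AlgEquiv.ext fun x => DFunLike.congr_fun h x)

theorem eq_of_sum_mul_algEquiv_eq [Fintype (L ≃ₐ[K] L)] {c d : (L ≃ₐ[K] L) → L}
    (h : ∀ y, ∑ σ, c σ * σ y = ∑ σ, d σ * σ y) : c = d := by
  have h0 := Fintype.linearIndependent_iff.1
    (linearIndependent_algEquiv_toLinearMap (K := K) (L := L)) (fun σ => c σ - d σ) (by
      ext y
      simp [sub_mul, Finset.sum_sub_distrib, h y])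
  funext σ
  exact sub_eq_zero.1 (h0 σ)

/-- The automorphisms of a finite Galois extension `L/K` form an `L`-basis of `End_K(L)`. -/
noncomputable def galoisEndBasis (K L : Type*) [Field K] [Field L] [Algebra K L]
    [FiniteDimensional K L] [IsGalois K L] : Module.Basis (L ≃ₐ[K] L) L (L →ₗ[K] L) :=
  basisOfLinearIndependentOfCardEqFinrank linearIndependent_algEquiv_toLinearMap (by
    rw [Module.finrank_linearMap_self, ← Nat.card_eq_fintype_card, IsGalois.card_aut_eq_finrank])

variable [FiniteDimensional K L] [IsGalois K L]

@[simp]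
theorem galoisEndBasis_apply (σ : L ≃ₐ[K] L) : galoisEndBasis K L σ = σ.toLinearMap := by
  simp [galoisEndBasis]

theorem sum_galoisEndBasis_repr_mul (f : L →ₗ[K] L) (y : L) :
    ∑ σ : L ≃ₐ[K] L, (galoisEndBasis K L).repr f σ * σ y = f y := by
  conv_rhs => rw [← (galoisEndBasis K L).sum_repr f]
  simp

end GaloisEnd

/-! ### Coefficients of the action, their Galois permutation, and descent. -/

namespace HopfGaloisStructure

variable {K L H : Type*} [Field K] [Field L] [Algebra K L] [Ring H] [HopfAlgebra K H]
  [FiniteDimensional K L]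

theorem finrank_eq (S : HopfGaloisStructure K L H) : Module.finrank K H = Module.finrank K L := by
  have := S.finite
  have e := (LinearEquiv.ofBijective _ S.bijective).finrank_eq
  rw [Module.finrank_tensorProduct, Module.finrank_linearMap] at e
  exact Nat.eq_of_mul_eq_mul_left Module.finrank_pos e

variable [IsGalois K L] (S : HopfGaloisStructure K L H)

/-- The coefficient of the automorphism `σ` in the action of an element of `H` on `L`. -/
noncomputable def coeff (σ : L ≃ₐ[K] L) : H →ₗ[K] L :=
  ((galoisEndBasis K L).coord σ).restrictScalars K ∘ₗ S.act.toLinearMap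

theorem act_eq_sum (h : H) (y : L) : S.act h y = ∑ σ : L ≃ₐ[K] L, S.coeff σ h * σ y :=
  (sum_galoisEndBasis_repr_mul (S.act h) y).symm

theorem coeff_eq_of_act {h : H} {c : (L ≃ₐ[K] L) → L} (hc : ∀ y, S.act h y = ∑ σ, c σ * σ y)
    (σ : L ≃ₐ[K] L) : S.coeff σ h = c σ := by
  have : (fun σ => S.coeff σ h) = c :=
    eq_of_sum_mul_algEquiv_eq fun y => by rw [← hc, ← act_eq_sum]
  exact congrFun this σ

open Classical in
theorem coeff_one (σ : L ≃ₐ[K] L) : S.coeff σ 1 = if σ = 1 then 1 else 0 := by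
  refine S.coeff_eq_of_act (c := fun σ => if σ = 1 then 1 else 0) (fun y => ?_) σ
  simp

theorem coeff_mul (h g : H) (ρ : L ≃ₐ[K] L) :
    S.coeff ρ (h * g) = ∑ σ : L ≃ₐ[K] L, S.coeff σ h * σ (S.coeff (σ⁻¹ * ρ) g) := by
  refine S.coeff_eq_of_act
    (c := fun ρ => ∑ σ : L ≃ₐ[K] L, S.coeff σ h * σ (S.coeff (σ⁻¹ * ρ) g)) (fun y => ?_) ρ
  rw [map_mul, Module.End.mul_apply, S.act_eq_sum h]
  simp_rw [Finset.sum_mul]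
  rw [Finset.sum_comm]
  refine Finset.sum_congr rfl fun σ _ => ?_
  rw [S.act_eq_sum g, map_sum, Finset.mul_sum]
  refine Fintype.sum_equiv (Equiv.mulLeft σ) _ _ fun τ => ?_
  simp [mul_assoc]

open Classical in
/-- The coefficients are orthogonal idempotents for the convolution product. -/
theorem sum_coeff_mul_coeff {h : H} {ι : Type*} (r : Coalgebra.Repr K h ι) (σ τ : L ≃ₐ[K] L) :
    ∑ i ∈ r.index, S.coeff σ (r.left i) * S.coeff τ (r.right i) =
      if σ = τ then S.coeff σ h else 0 := by
  have key : ∀ x y : L,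
      ∑ σ : L ≃ₐ[K] L, (∑ τ : L ≃ₐ[K] L,
        (∑ i ∈ r.index, S.coeff σ (r.left i) * S.coeff τ (r.right i)) * τ y) * σ x =
      ∑ σ : L ≃ₐ[K] L, (∑ τ : L ≃ₐ[K] L, (if σ = τ then S.coeff σ h else 0) * τ y) * σ x := by
    intro x y
    trans S.act h (x * y)
    · rw [S.act_mul, ← r.eq, map_sum, map_sum]
      simp only [TensorProduct.map_tmul, LinearMap.mul'_apply, LinearMap.flip_apply,
        AlgHom.toLinearMap_apply, S.act_eq_sum, Finset.sum_mul_sum]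
      simp only [Finset.sum_mul]
      symm
      rw [Finset.sum_comm' (t' := Finset.univ) (s' := fun _ => r.index) (by simp)]
      refine Finset.sum_congr rfl fun σ _ => ?_
      rw [Finset.sum_comm]
      refine Finset.sum_congr rfl fun i _ => Finset.sum_congr rfl fun τ _ => ?_
      ring
    · rw [S.act_eq_sum]
      refine Finset.sum_congr rfl fun σ _ => ?_
      simp only [ite_mul, zero_mul, Finset.sum_ite_eq, Finset.mem_univ, if_true, map_mul]
      ring
  -- Both sides expand `h · (x y)`; Dedekind independence is used in `x`, then in `y`.
  have h1 : ∀ y, _ := fun y => eq_of_sum_mul_algEquiv_eq fun x => key x y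
  have h2 := eq_of_sum_mul_algEquiv_eq fun y => congrFun (h1 y) σ
  exact congrFun h2 τ

/-- A linear relation among the coefficients is an `L`-linear functional on `End_K(L)` that kills
the image of `j`. As `j` is onto, the functional vanishes, in particular on each automorphism. -/
theorem linearIndependent_coeff :
    LinearIndependent L (fun σ : L ≃ₐ[K] L => (S.coeff σ : H →ₗ[K] L)) := by
  rw [Fintype.linearIndependent_iff]
  intro c hc
  let φ : (L →ₗ[K] L) →ₗ[L] L := (galoisEndBasis K L).constr L c
  have hφ : ∀ f, φ f = 0 := by
    intro f
    obtain ⟨z, rfl⟩ := S.bijective.2 f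
    induction z with
    | zero => simp
    | add x y hx hy => rw [map_add, map_add, hx, hy, add_zero]
    | tmul x h =>
      have e : (TensorProduct.lift
          ((LinearMap.mul K (Module.End K L)).compl₁₂ (Algebra.lmul K L).toLinearMap
          S.act.toLinearMap) : L ⊗[K] H →ₗ[K] Module.End K L) (x ⊗ₜ h) =
          x • (S.act h : L →ₗ[K] L) := by
        ext y
        simp
      rw [e, map_smul, Module.Basis.constr_apply_fintype]
      have := LinearMap.congr_fun hc h
      simp only [LinearMap.sum_apply, LinearMap.smul_apply, LinearMap.zero_apply] at this
      simp only [smul_eq_mul]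
      rw [mul_eq_zero]
      right
      rw [← this]
      exact Finset.sum_congr rfl fun σ _ => mul_comm _ _
  intro σ
  have := hφ (galoisEndBasis K L σ)
  rwa [Module.Basis.constr_basis] at this

theorem exists_eq_sum_coeff (b : H →ₗ[K] L) :
    ∃ c : (L ≃ₐ[K] L) → L, ∀ h, b h = ∑ σ : L ≃ₐ[K] L, c σ * S.coeff σ h := by
  have := S.finite
  let B := basisOfLinearIndependentOfCardEqFinrank S.linearIndependent_coeff (by
    rw [← Nat.card_eq_fintype_card, IsGalois.card_aut_eq_finrank, ← S.finrank_eq]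
    simp [Module.finrank_linearMap])
  refine ⟨fun σ => B.repr b σ, fun h => ?_⟩
  conv_lhs => rw [← B.sum_repr b]
  simp [B]

theorem eq_of_sum_mul_coeff_eq {c d : (L ≃ₐ[K] L) → L}
    (h : ∀ x, ∑ σ, c σ * S.coeff σ x = ∑ σ, d σ * S.coeff σ x) : c = d := by
  have h0 := Fintype.linearIndependent_iff.1 S.linearIndependent_coeff
    (fun σ => c σ - d σ) (by
      ext y
      simp [sub_mul, Finset.sum_sub_distrib, h y])
  funext σ
  exact sub_eq_zero.1 (h0 σ)

theorem coeff_injective {σ τ : L ≃ₐ[K] L} (h : ∀ x, S.coeff σ x = S.coeff τ x) : σ = τ :=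
  S.linearIndependent_coeff.injective (LinearMap.ext h)

/-- The Galois group permutes the coefficients. -/
theorem exists_algEquiv_coeff (x σ : L ≃ₐ[K] L) :
    ∃ ρ : L ≃ₐ[K] L, ∀ h, x (S.coeff σ h) = S.coeff ρ h := by
  classical
  choose c hc using fun σ => S.exists_eq_sum_coeff (x.toLinearMap ∘ₗ S.coeff σ)
  simp only [LinearMap.comp_apply, AlgEquiv.toLinearMap_apply] at hc
  -- The maps `x ∘ c_σ` are again orthogonal idempotents, since `x` is a ring automorphism. In the
  -- basis of coefficients convolution is coordinatewise, so for each `ρ` the entries `c σ ρ` are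
  -- orthogonal idempotents of the field `L`.
  have hmul : ∀ σ τ ρ, c σ ρ * c τ ρ = if σ = τ then c σ ρ else 0 := by
    intro σ τ ρ
    suffices (fun ρ => c σ ρ * c τ ρ) = fun ρ => if σ = τ then c σ ρ else 0 from
      congrFun this ρ
    refine S.eq_of_sum_mul_coeff_eq fun h => ?_
    let r := Coalgebra.Repr.arbitrary K h
    have h1 : ∑ i ∈ r.index, x (S.coeff σ (r.left i)) * x (S.coeff τ (r.right i)) =
        if σ = τ then x (S.coeff σ h) else 0 := by
      simp_rw [← map_mul, ← map_sum]
      rw [S.sum_coeff_mul_coeff r]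
      split_ifs <;> simp
    simp_rw [hc, Finset.sum_mul_sum] at h1
    rw [Finset.sum_comm' (t' := Finset.univ) (s' := fun _ => r.index) (by simp)] at h1
    have h2 : ∀ ρ, ∑ i ∈ r.index, ∑ ρ', c σ ρ * S.coeff ρ (r.left i) *
        (c τ ρ' * S.coeff ρ' (r.right i)) = c σ ρ * c τ ρ * S.coeff ρ h := by
      intro ρ
      rw [Finset.sum_comm]
      trans ∑ ρ', c σ ρ * c τ ρ' *
        ∑ i ∈ r.index, S.coeff ρ (r.left i) * S.coeff ρ' (r.right i)
      · refine Finset.sum_congr rfl fun ρ' _ => ?_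
        rw [Finset.mul_sum]
        exact Finset.sum_congr rfl fun i _ => by ring
      · simp [S.sum_coeff_mul_coeff r]
    simp_rw [h2] at h1
    rw [h1]
    split_ifs <;> simp
  have hex : ∀ σ, ∃ ρ, c σ ρ = 1 := by
    intro σ
    by_contra! hne
    have h0 : ∀ ρ, c σ ρ = 0 := fun ρ => by
      have := hmul σ σ ρ
      rw [if_pos rfl] at this
      by_contra h0
      exact hne ρ (mul_left_cancel₀ h0 (by rw [this, mul_one]))
    have : ∀ h, S.coeff σ h = 0 := fun h => by
      have := hc σ h
      simpa [h0] using this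
    exact S.linearIndependent_coeff.ne_zero σ (LinearMap.ext this)
  choose f hf using hex
  -- Orthogonality forbids two rows with a `1` in the same column. Thus `f` is a permutation, every
  -- column has a `1`, and all other entries vanish.
  have hinj : Function.Injective f := by
    intro σ τ e
    by_contra hne
    have := hmul σ τ (f σ)
    rw [if_neg hne, hf, e, hf] at this
    simp at this
  refine ⟨f σ, fun h => ?_⟩
  rw [hc, Finset.sum_eq_single (f σ), hf, one_mul]
  · intro ρ _ hρ
    obtain ⟨τ, rfl⟩ := (Finite.injective_iff_surjective.1 hinj) ρ
    have := hmul σ τ (f τ)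
    rw [if_neg (fun e => hρ (by rw [e])), hf, mul_one] at this
    rw [this, zero_mul]
  · simp

/-- The permutation of `Gal(L/K)` by which the automorphism `x` permutes the coefficients. -/
noncomputable def twist (x σ : L ≃ₐ[K] L) : L ≃ₐ[K] L := (S.exists_algEquiv_coeff x σ).choose

theorem algEquiv_coeff (x σ : L ≃ₐ[K] L) (h : H) :
    x (S.coeff σ h) = S.coeff (S.twist x σ) h :=
  (S.exists_algEquiv_coeff x σ).choose_spec h

theorem twist_one_left (σ : L ≃ₐ[K] L) : S.twist 1 σ = σ :=
  S.coeff_injective fun h => by rw [← algEquiv_coeff]; rfl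

theorem twist_mul (x y σ : L ≃ₐ[K] L) : S.twist (x * y) σ = S.twist x (S.twist y σ) :=
  S.coeff_injective fun h => by simp only [← algEquiv_coeff]; rfl

theorem twist_one_right (x : L ≃ₐ[K] L) : S.twist x 1 = 1 := by
  classical
  have h := S.algEquiv_coeff x 1 1
  rw [coeff_one, coeff_one, if_pos rfl, map_one] at h
  by_contra hne
  rw [if_neg hne] at h
  exact one_ne_zero h

/-- Galois descent: `H` realizes every family of coefficients on which the Galois group
acts through `twist`. -/
theorem exists_coeff_eq [CharZero K] (c : (L ≃ₐ[K] L) → L)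
    (hc : ∀ x σ, x (c σ) = c (S.twist x σ)) : ∃ h : H, ∀ y, S.act h y = ∑ σ, c σ * σ y := by
  let j : L ⊗[K] H →ₗ[K] Module.End K L := TensorProduct.lift
      ((LinearMap.mul K (Module.End K L)).compl₁₂ (Algebra.lmul K L).toLinearMap
        S.act.toLinearMap)
  -- The map `y ⊗ h ↦ Tr(y) h` sums over the Galois group. On the preimage under `j` of an
  -- equivariant family it multiplies the coefficients by the group order, which is invertible in
  -- characteristic zero.
  let T : L ⊗[K] H →ₗ[K] H := TensorProduct.lift (LinearMap.lsmul K H ∘ₗ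
    Algebra.trace K L)
  have hT : ∀ z σ, S.coeff σ (T z) = ∑ x : L ≃ₐ[K] L,
      x ((galoisEndBasis K L).repr (j z) (S.twist x⁻¹ σ)) := by
    intro z σ
    induction z with
    | zero => simp
    | add z w hz hw => simp [hz, hw, Finset.sum_add_distrib]
    | tmul y h =>
      have e : j (y ⊗ₜ h) = y • (S.act h : L →ₗ[K] L) := by
        ext y
        simp [j]
      have e2 : ∀ x : L ≃ₐ[K] L, x ((galoisEndBasis K L).repr (j (y ⊗ₜ h)) (S.twist x⁻¹ σ)) =
          x y * S.coeff σ h := by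
        intro x
        rw [e, map_smul, Finsupp.smul_apply, smul_eq_mul, map_mul]
        have := S.algEquiv_coeff x (S.twist x⁻¹ σ) h
        rw [← twist_mul, mul_inv_cancel, twist_one_left] at this
        rw [← this]
        rfl
      simp_rw [e2, ← Finset.sum_mul, ← trace_eq_sum_automorphisms]
      simp only [T, TensorProduct.lift.tmul, LinearMap.comp_apply, LinearMap.lsmul_apply]
      rw [map_smul, Algebra.smul_def]
  obtain ⟨z, hz⟩ := S.bijective.2 (∑ σ, c σ • σ.toLinearMap : L →ₗ[K] L)
  have hcz : ∀ σ, (galoisEndBasis K L).repr (j z) σ = c σ := by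
    intro σ
    have : (fun σ => (galoisEndBasis K L).repr (j z) σ) = c :=
      eq_of_sum_mul_algEquiv_eq fun y => by
        rw [sum_galoisEndBasis_repr_mul]
        change (j z) y = _
        rw [show j z = (∑ σ, c σ • σ.toLinearMap : L →ₗ[K] L) from hz]
        simp
    exact congrFun this σ
  have hN : (Fintype.card (L ≃ₐ[K] L) : K) ≠ 0 := Nat.cast_ne_zero.2 Fintype.card_ne_zero
  refine ⟨(Fintype.card (L ≃ₐ[K] L) : K)⁻¹ • T z, fun y => ?_⟩
  rw [act_eq_sum]
  refine Finset.sum_congr rfl fun σ _ => ?_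
  congr 1
  have h1 : ∀ x : L ≃ₐ[K] L, x (c (S.twist x⁻¹ σ)) = c σ := by
    intro x
    rw [hc, ← twist_mul, mul_inv_cancel, twist_one_left]
  rw [map_smul, hT]
  simp_rw [hcz, h1]
  rw [Finset.sum_const, Finset.card_univ, ← Nat.cast_smul_eq_nsmul K, smul_smul,
    inv_mul_cancel₀ hN, one_smul]

end HopfGaloisStructure

/-! ### Actions of a Klein four-group on its own underlying set. -/

section KleinFour

variable {G : Type*} [Group G] [IsKleinFour G]

theorem IsKleinFour.eq_or {p q : G} (hp : p ≠ 1) (hq : q ≠ 1) (hpq : p ≠ q) (x : G) :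
    x = p * q ∨ x = p ∨ x = q ∨ x = 1 := by
  by_contra! h
  exact h.1 (IsKleinFour.eq_mul_of_ne_all hp hq hpq h.2.2.2 h.2.1 h.2.2.1)

theorem IsKleinFour.mul_comm' (x y : G) : x * y = y * x :=
  (IsKleinFour.isMulCommutative (G := G)).is_comm.comm x y

theorem IsKleinFour.sum_eq [Fintype G] {M : Type*} [AddCommMonoid M] {p q : G} (hp : p ≠ 1)
    (hq : q ≠ 1) (hpq : p ≠ q) (f : G → M) : ∑ x, f x = f 1 + f (p * q) + f p + f q := by
  classical
  have h1 : p * q ≠ 1 := fun e => hpq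
    (mul_left_cancel (e.trans (IsKleinFour.mul_self p).symm)).symm
  have h2 : p * q ≠ p := fun e => hq (by simpa using e)
  have h3 : p * q ≠ q := fun e => hp (by simpa using e)
  rw [← IsKleinFour.eq_finset_univ hp hq hpq, Finset.sum_insert, Finset.sum_insert,
    Finset.sum_insert, Finset.sum_singleton]
  · abel
  all_goals simp_all

/-- An action of a Klein four-group on its own underlying set that fixes the identity is either
trivial, or it swaps two elements `p`, `q` and fixes `p * q`; up to exchanging `p` and `q`, then,
the kernel is generated by `p` or by `p * q`. -/
theorem IsKleinFour.action_fixing_one (π : G → G → G) (h1 : ∀ g, π 1 g = g)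
    (hmul : ∀ x y g, π (x * y) g = π x (π y g)) (hone : ∀ x, π x 1 = 1) :
    (∀ x g, π x g = g) ∨ ∃ p q : G, p ≠ 1 ∧ q ≠ 1 ∧ p ≠ q ∧ (∀ x, π x (p * q) = p * q) ∧
      (∀ x, (π x p = p ∧ π x q = q) ∨ (π x p = q ∧ π x q = p)) ∧
      ((π p p = p ∧ π q q = p) ∨ (π p p = q ∧ π q p = q ∧ π (p * q) p = p)) := by
  by_cases htriv : ∀ x g, π x g = g
  · exact Or.inl htriv
  right
  push Not at htriv
  obtain ⟨x, p, hxp⟩ := htriv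
  have hinv : ∀ y g, π y (π y g) = g := fun y g => by rw [← hmul, IsKleinFour.mul_self, h1]
  have hinj : ∀ y, Function.Injective (π y) := fun y a b e => by
    rw [← hinv y a, e, hinv]
  have hp : p ≠ 1 := by rintro rfl; exact hxp (hone x)
  obtain ⟨q, hq⟩ : ∃ q, π x p = q := ⟨_, rfl⟩
  have hq1 : q ≠ 1 := by rintro rfl; exact hp (hinj x (hq.trans (hone x).symm))
  have hpq : p ≠ q := by rintro rfl; exact hxp hq
  have hxq : π x q = p := by rw [← hq, hinv]
  have hc : ∀ a b c, π a (π b c) = π b (π a c) := fun a b c => by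
    rw [← hmul, ← hmul, IsKleinFour.mul_comm']
  have hor := IsKleinFour.eq_or hp hq1 hpq
  have hpq1 : p * q ≠ 1 := fun e => hpq
    (mul_left_cancel (e.trans (IsKleinFour.mul_self p).symm)).symm
  have hpqp : p * q ≠ p := fun e => hq1 (by simpa using e)
  have hpqq : p * q ≠ q := fun e => hp (by simpa using e)
  have hxr : π x (p * q) = p * q := by
    rcases hor (π x (p * q)) with e | e | e | e
    · exact e
    · exact absurd (hinj x (e.trans hxq.symm)) hpqq
    · exact absurd (hinj x (e.trans hq.symm)) hpqp
    · exact absurd (hinj x (e.trans (hone x).symm)) hpq1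
  have hy : ∀ y, (π y p = p ∧ π y q = q) ∨ (π y p = q ∧ π y q = p) := by
    intro y
    rcases hor (π y p) with e | e | e | e
    · have h2 : π y q = p * q := by rw [← hq, hc, e, hxr, hq]
      exact absurd (hinj y (e.trans h2.symm)) hpq
    · exact Or.inl ⟨e, by rw [← hq, hc, e]⟩
    · exact Or.inr ⟨e, by rw [← hq, hc, e, hxq]⟩
    · exact absurd (hinj y (e.trans (hone y).symm)) hp
  have hr : ∀ y, π y (p * q) = p * q := by
    intro y
    rcases hor (π y (p * q)) with e | e | e | e
    · exact e
    · rcases hy y with h | h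
      · exact absurd (hinj y (e.trans h.1.symm)) hpqp
      · exact absurd (hinj y (e.trans h.2.symm)) hpqq
    · rcases hy y with h | h
      · exact absurd (hinj y (e.trans h.2.symm)) hpqq
      · exact absurd (hinj y (e.trans h.1.symm)) hpqp
    · exact absurd (hinj y (e.trans (hone y).symm)) hpq1
  -- The action is determined by whether `p` and `q` each act trivially or by the swap. Not both act
  -- trivially; the two mixed cases agree up to renaming.
  rcases hy p with hpt | hps <;> rcases hy q with hqt | hqs
  · exfalso
    rcases hor x with rfl | rfl | rfl | rfl
    · rw [hmul, hqt.1, hpt.1] at hq; exact hpq hq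
    · exact hxp hpt.1
    · exact hxp hqt.1
    · exact hxp (h1 p)
  · exact ⟨p, q, hp, hq1, hpq, hr, hy, Or.inl ⟨hpt.1, hqs.2⟩⟩
  · refine ⟨q, p, hq1, hp, hpq.symm, fun y => ?_, fun y => ?_, Or.inl ⟨hqt.2, hps.1⟩⟩
    · rw [IsKleinFour.mul_comm' q p, hr]
    · rcases hy y with h | h
      · exact Or.inl h.symm
      · exact Or.inr h.symm
  · exact ⟨p, q, hp, hq1, hpq, hr, hy, Or.inr ⟨hps.1, hqs.1, by rw [hmul, hqs.1, hps.2]⟩⟩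

end KleinFour

/-! ### Hopf–Galois structures on a biquadratic extension. -/

namespace HopfGaloisStructure

variable {K L H : Type*} [Field K] [Field L] [Algebra K L] [Ring H] [HopfAlgebra K H]
  [FiniteDimensional K L] [IsGalois K L] [CharZero K] [IsKleinFour (L ≃ₐ[K] L)]

/-- A swap of `p` and `q` with kernel generated by `p` is incompatible with products in `H`: the
coefficient of `1` in `h * g` would fail to be Galois invariant. The kernel is then generated by `r
= p * q`, and any `p` outside it may serve as the swapped element. -/
theorem twist_eq_or (S : HopfGaloisStructure K L H) :
    (∀ x σ, S.twist x σ = σ) ∨ ∃ r : L ≃ₐ[K] L, r ≠ 1 ∧ ∀ p : L ≃ₐ[K] L, p ≠ 1 → p ≠ r →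
      (∀ x, S.twist x r = r) ∧ S.twist r p = p ∧ S.twist p p = p * r ∧ S.twist p (p * r) = p ∧
        S.twist r (p * r) = p * r := by
  rcases IsKleinFour.action_fixing_one S.twist S.twist_one_left S.twist_mul S.twist_one_right with
    h | ⟨p, q, hp, hq, hpq, hr, hy, hbad | hgood⟩
  · exact Or.inl h
  · exfalso
    have hfix : ∀ (h : H) (x : L ≃ₐ[K] L), x (S.coeff p h + S.coeff q h) = S.coeff p h + S.coeff q h := by
      intro h x
      rw [map_add, S.algEquiv_coeff, S.algEquiv_coeff]
      rcases hy x with e | e <;> rw [e.1, e.2]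
      rw [add_comm]
    have hid : ∀ h g, S.coeff 1 (h * g) = S.coeff 1 h * S.coeff 1 g +
        S.coeff (p * q) h * S.coeff (p * q) g + (S.coeff p h + S.coeff q h) * S.coeff p g := by
      intro h g
      rw [S.coeff_mul, IsKleinFour.sum_eq hp hq hpq]
      simp only [mul_one, IsKleinFour.inv_eq_self, S.algEquiv_coeff, hbad.1, hbad.2, hr,
        S.twist_one_left]
      ring
    have hqp : S.twist q p = q := by
      rcases hy q with e | e
      · exact absurd (hbad.2.symm.trans e.2) hpq
      · exact e.1
    -- Apply `q` to `hid`: every term is fixed except the last factor, which becomes `S.coeff q g`.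
    have hzero : ∀ h g, (S.coeff p h + S.coeff q h) * (S.coeff q g - S.coeff p g) = 0 := by
      intro h g
      have e := congrArg q (hid h g)
      rw [map_add q, map_add q, map_mul q, map_mul q, map_mul q, hfix] at e
      simp only [S.algEquiv_coeff, hr, S.twist_one_right, hqp] at e
      linear_combination hid h g - e
    -- The sum of all automorphisms lies in `H`; for it the first factor in `hzero` is `2`.
    obtain ⟨h, hh⟩ := S.exists_coeff_eq (fun _ => 1) (by simp)
    have hc := S.coeff_eq_of_act hh
    refine hpq (S.coeff_injective fun g => ?_)
    have := hzero h g
    rw [hc, hc] at this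
    have h2 : (1 + 1 : L) ≠ 0 := by
      have : CharZero L := charZero_of_injective_algebraMap (algebraMap K L).injective
      norm_num
    exact (sub_eq_zero.1 ((mul_eq_zero.1 this).resolve_left h2)).symm
  · right
    have hqs : ∀ x, S.twist x p = q → S.twist x q = p := fun x hx => by
      rcases hy x with e | e
      · exact absurd (e.1.symm.trans hx) hpq
      · exact e.2
    have hqt : ∀ x, S.twist x p = p → S.twist x q = q := fun x hx => by
      rcases hy x with e | e
      · exact e.2
      · exact absurd (hx.symm.trans e.1) hpq
    refine ⟨p * q, fun e => hpq (mul_left_cancel (e.trans (IsKleinFour.mul_self p).symm)).symm,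
      fun s hs1 hsr => ?_⟩
    have e1 : p * (p * q) = q := by rw [← mul_assoc, IsKleinFour.mul_self, one_mul]
    have e2 : q * (p * q) = p := by
      rw [IsKleinFour.mul_comm' p q, ← mul_assoc, IsKleinFour.mul_self, one_mul]
    rcases IsKleinFour.eq_or hp hq hpq s with rfl | rfl | rfl | rfl
    · exact absurd rfl hsr
    · rw [e1]
      exact ⟨hr, hgood.2.2, hgood.1, hqs _ hgood.1, hqt _ hgood.2.2⟩
    · rw [e2]
      exact ⟨hr, hqt _ hgood.2.2, hqs _ hgood.2.1, hgood.2.1, hgood.2.2⟩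
    · exact absurd rfl hs1

/-- The Hopf–Galois structures on a biquadratic extension: either `H` acts through all `K`-linear
combinations of the Galois group, or there is an involution `r` such that `H` contains
the elements `a + b r + (c + z) p + (c - z) p r`, for `z` fixed by `r` and negated by `p`. -/
theorem exists_act (S : HopfGaloisStructure K L H) :
    (∀ r p : L ≃ₐ[K] L, r ≠ 1 → p ≠ 1 → p ≠ r → ∀ a b c d : K, ∃ h : H, ∀ y, S.act h y =
      algebraMap K L a * y + algebraMap K L b * r y + algebraMap K L c * p y +
        algebraMap K L d * p (r y)) ∨
    ∃ r : L ≃ₐ[K] L, r ≠ 1 ∧ ∀ p : L ≃ₐ[K] L, p ≠ 1 → p ≠ r → ∀ (a b c : K) (z : L), r z = z →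
      p z = -z → ∃ h : H, ∀ y, S.act h y = algebraMap K L a * y + algebraMap K L b * r y +
        (algebraMap K L c + z) * p y + (algebraMap K L c - z) * p (r y) := by
  classical
  have hsum : ∀ {r p : L ≃ₐ[K] L}, r ≠ 1 → p ≠ 1 → p ≠ r → ∀ (a b c d y : L),
      ∑ σ, (if σ = 1 then a else if σ = r then b else if σ = p then c else d) * σ y =
        a * y + b * r y + c * p y + d * p (r y) := by
    intro r p hr hp hpr a b c d y
    have h1 : p * r ≠ 1 := fun e => hpr (mul_left_cancel
      (e.trans (IsKleinFour.mul_self p).symm)).symm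
    have h2 : p * r ≠ p := fun e => hr (by simpa using e)
    have h3 : p * r ≠ r := fun e => hp (by simpa using e)
    rw [IsKleinFour.sum_eq hp hr hpr]
    simp only [h1, h2, h3, hr, hp, hpr, if_true, if_false, AlgEquiv.one_apply, AlgEquiv.mul_apply]
    ring
  rcases S.twist_eq_or with h | ⟨r, hr, h⟩
  · refine Or.inl fun r p hr hp hpr a b c d => ?_
    obtain ⟨g, hg⟩ := S.exists_coeff_eq (fun σ => if σ = 1 then algebraMap K L a else
      if σ = r then algebraMap K L b else if σ = p then algebraMap K L c else algebraMap K L d)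
      (fun x σ => by rw [h]; split_ifs <;> simp)
    exact ⟨g, fun y => by rw [hg, hsum hr hp hpr]⟩
  · refine Or.inr ⟨r, hr, fun p hp hpr a b c z hrz hpz => ?_⟩
    obtain ⟨hr1, h2, h3, h4, h5⟩ := h p hp hpr
    have n1 : p * r ≠ 1 := fun e => hpr (mul_left_cancel
      (e.trans (IsKleinFour.mul_self p).symm)).symm
    have n2 : p * r ≠ p := fun e => hr (by simpa using e)
    have n3 : p * r ≠ r := fun e => hp (by simpa using e)
    obtain ⟨g, hg⟩ := S.exists_coeff_eq (fun σ => if σ = 1 then algebraMap K L a else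
      if σ = r then algebraMap K L b else if σ = p then algebraMap K L c + z else
        algebraMap K L c - z) (fun x σ => by
        rcases IsKleinFour.eq_or hp hr hpr x with rfl | rfl | rfl | rfl <;>
        rcases IsKleinFour.eq_or hp hr hpr σ with rfl | rfl | rfl | rfl <;>
        simp [S.twist_mul, S.twist_one_right, S.twist_one_left, *] <;> ring)
    exact ⟨g, fun y => by rw [hg, hsum hr hp hpr]⟩

end HopfGaloisStructure

/-! ### Integrality in quadratic fields. -/

section RationalSquares

theorem IsIntegral.of_eq {R A : Type*} [CommRing R] [Ring A] [Algebra R A] {x y : A}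
    (h : IsIntegral R x) (e : x = y) : IsIntegral R y :=
  e ▸ h

theorem Rat.exists_int_eq_of_isIntegral {L : Type*} [Field L] [CharZero L] {q : ℚ}
    (h : IsIntegral ℤ (q : L)) : ∃ z : ℤ, (z : ℚ) = q := by
  have h1 : IsIntegral ℤ q := by
    rw [← isIntegral_algebraMap_iff (algebraMap ℚ L).injective]
    simpa using h
  simpa using IsIntegrallyClosed.isIntegral_iff.1 h1

theorem Rat.exists_int_eq_of_sq {q : ℚ} {z : ℤ} (h : q ^ 2 = z) : ∃ w : ℤ, (w : ℚ) = q := by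
  have : IsIntegral ℤ (q ^ 2) := h ▸ isIntegral_algebraMap (A := ℚ) (x := z)
  simpa using IsIntegrallyClosed.isIntegral_iff.1 (this.of_pow two_pos)

theorem Int.sq_emod_four (x : ℤ) : x ^ 2 % 4 = 0 ∧ x % 2 = 0 ∨ x ^ 2 % 4 = 1 ∧ x % 2 = 1 := by
  rcases Int.even_or_odd' x with ⟨y, rfl | rfl⟩
  · left
    ring_nf
    omega
  · right
    ring_nf
    omega

theorem Rat.sq_ne_of_emod_four {D : ℤ} (hD : D % 4 = 2 ∨ D % 4 = 3) (q : ℚ) : q ^ 2 ≠ D := by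
  intro h
  obtain ⟨w, rfl⟩ := Rat.exists_int_eq_of_sq h
  have h1 : w ^ 2 = D := by exact_mod_cast h
  have := Int.sq_emod_four w
  omega

theorem Rat.exists_int_eq_of_squarefree_mul_sq {D : ℤ} (hD : Squarefree D) {q : ℚ} {z : ℤ}
    (h : D * q ^ 2 = z) : ∃ w : ℤ, (w : ℚ) = q := by
  have hD0 : (D : ℚ) ≠ 0 := Int.cast_ne_zero.2 hD.ne_zero
  obtain ⟨w, hw⟩ := Rat.exists_int_eq_of_sq (q := D * q) (z := D * z) (by
    push_cast; rw [← h]; ring)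
  have h1 : w ^ 2 = D * z := by
    have : (w : ℚ) ^ 2 = D * z := by rw [hw, ← h]; ring
    exact_mod_cast this
  obtain ⟨t, rfl⟩ := (hD.dvd_pow_iff_dvd two_ne_zero).1 (Dvd.intro _ h1.symm)
  refine ⟨t, mul_left_cancel₀ hD0 ?_⟩
  rw [← hw]
  push_cast
  ring

theorem Rat.eq_zero_of_sq_eq_mul_sq {D : ℤ} (hD : D % 4 = 2 ∨ D % 4 = 3) {a b : ℚ}
    (h : a ^ 2 = D * b ^ 2) : a = 0 ∧ b = 0 := by
  by_cases hb : b = 0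
  · subst hb
    simpa using h
  · refine absurd ?_ (Rat.sq_ne_of_emod_four hD (a / b))
    rw [div_pow, div_eq_iff (pow_ne_zero 2 hb), h]

variable {L : Type*} [Field L] [CharZero L]

theorem eq_zero_of_add_mul_sqrt_eq_zero {D : ℤ} (hD : D % 4 = 2 ∨ D % 4 = 3) {R : L}
    (hR : R ^ 2 = D) {a b : ℚ} (h : (a : L) + b * R = 0) : a = 0 ∧ b = 0 := by
  refine Rat.eq_zero_of_sq_eq_mul_sq hD ?_
  have : (a : L) ^ 2 = D * b ^ 2 := by
    rw [eq_neg_of_add_eq_zero_left h, ← hR]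
    ring
  exact_mod_cast this

/-- An integral element of a quadratic field `ℚ(√D)`, where `D ≡ 2, 3` modulo `4`, has integral
coordinates. -/
theorem exists_int_of_isIntegral_quadratic {D : ℤ} (hD : D % 4 = 2 ∨ D % 4 = 3)
    (hDs : Squarefree D) {R : L} (hR : R ^ 2 = D) {a b : ℚ} (h : IsIntegral ℤ ((a : L) + b * R))
    (h' : IsIntegral ℤ ((a : L) - b * R)) : ∃ x y : ℤ, (x : ℚ) = a ∧ (y : ℚ) = b := by
  obtain ⟨x, hx⟩ := Rat.exists_int_eq_of_isIntegral (L := L) (q := 2 * a)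
    ((h.add h').of_eq (by push_cast; ring))
  obtain ⟨z, hz⟩ := Rat.exists_int_eq_of_isIntegral (L := L) (q := a ^ 2 - D * b ^ 2)
    ((h.mul h').of_eq (by push_cast; rw [← hR]; ring))
  obtain ⟨y, hy⟩ := Rat.exists_int_eq_of_squarefree_mul_sq hDs (q := 2 * b) (z := x ^ 2 - 4 * z) (by
    push_cast; rw [hx, hz]; ring)
  have h1 : x ^ 2 - D * y ^ 2 = 4 * z := by
    have : (x : ℚ) ^ 2 - D * y ^ 2 = 4 * z := by rw [hx, hy, hz]; ring
    exact_mod_cast this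
  have h2 : x % 2 = 0 ∧ y % 2 = 0 := by
    have hx2 := Int.sq_emod_four x
    have hy2 := Int.sq_emod_four y
    have h3 : D * y ^ 2 % 4 = (D % 4) * (y ^ 2 % 4) % 4 := Int.mul_emod _ _ _
    rcases hD with e | e <;> rcases hy2 with ⟨f, f'⟩ | ⟨f, f'⟩ <;> rw [e, f] at h3 <;> omega
  obtain ⟨u, hu⟩ := Int.dvd_of_emod_eq_zero h2.1
  obtain ⟨v, hv⟩ := Int.dvd_of_emod_eq_zero h2.2
  refine ⟨u, v, ?_, ?_⟩
  · rw [hu] at hx; push_cast at hx; linarith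
  · rw [hv] at hy; push_cast at hy; linarith

end RationalSquares

/-! ### Galois group and integral basis of the biquadratic field with `n = ±2`. -/

/-- The extension `L = ℚ(√m, √n)` for a square-free integer `m ≡ 3` modulo `4` and `n = ± 2`,
where `P = √m` and `N = √n`. -/
structure IsBiquadraticTwo {L : Type*} [Field L] [NumberField L] (m n : ℤ) (P N : L) : Prop where
  squarefree : Squarefree m
  emod : m % 4 = 3
  eq_two_or : n = 2 ∨ n = -2
  sq_left : P ^ 2 = m
  sq_right : N ^ 2 = n
  adjoin_eq : IntermediateField.adjoin ℚ {P, N} = (⊤ : IntermediateField ℚ L)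

namespace IsBiquadraticTwo

variable {L : Type*} [Field L] [NumberField L] {m n : ℤ} {P N : L}

theorem emod_right (B : IsBiquadraticTwo m n P N) : n % 4 = 2 := by
  rcases B.eq_two_or with rfl | rfl <;> rfl

theorem emod_mul (B : IsBiquadraticTwo m n P N) : m * n % 4 = 2 := by
  rw [Int.mul_emod, B.emod, B.emod_right]
  rfl

theorem sq_mul (B : IsBiquadraticTwo m n P N) : (P * N) ^ 2 = ((m * n : ℤ) : L) := by
  rw [mul_pow, B.sq_left, B.sq_right]
  push_cast
  rfl

theorem squarefree_right (B : IsBiquadraticTwo m n P N) : Squarefree n := by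
  have : Squarefree (2 : ℤ) := Int.prime_two.squarefree
  rcases B.eq_two_or with rfl | rfl
  · exact this
  · exact this.squarefree_of_dvd (by norm_num)

theorem squarefree_mul (B : IsBiquadraticTwo m n P N) : Squarefree (m * n) := by
  refine squarefree_mul_iff.2 ⟨?_, B.squarefree, B.squarefree_right⟩
  apply IsCoprime.isRelPrime
  have hm := B.emod
  obtain ⟨t, ht⟩ : ∃ t, m = 2 * t + 1 := ⟨m / 2, by omega⟩
  rcases B.eq_two_or with rfl | rfl
  · exact ⟨1, -t, by rw [ht]; ring⟩
  · exact ⟨1, t, by rw [ht]; ring⟩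

theorem eq_zero_of_sum_eq_zero (B : IsBiquadraticTwo m n P N) {a b c d : ℚ}
    (h : (a : L) + b * P + c * N + d * (P * N) = 0) : a = 0 ∧ b = 0 ∧ c = 0 ∧ d = 0 := by
  have hm := B.emod
  have hn := B.emod_right
  have hmn := B.emod_mul
  have h0 : ((a : L) + b * P) ^ 2 = n * (c + d * P) ^ 2 := by
    rw [show (a : L) + b * P = - ((c + d * P) * N) by linear_combination h, ← B.sq_right]
    ring
  obtain ⟨h1, h2⟩ := eq_zero_of_add_mul_sqrt_eq_zero (Or.inr hm) B.sq_left
    (a := a ^ 2 + m * b ^ 2 - n * (c ^ 2 + m * d ^ 2)) (b := 2 * (a * b - n * c * d)) (by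
      push_cast
      rw [← B.sq_left]
      linear_combination h0)
  -- Norms to `ℚ` of the two sides of `h0`, as a difference of squares. With `h1`, each factor makes
  -- `n` or `m * n` a rational square unless the coordinates vanish, and both are `2` modulo `4`.
  have h3 : (a ^ 2 - m * b ^ 2 - n * (c ^ 2 - m * d ^ 2)) *
      (a ^ 2 - m * b ^ 2 + n * (c ^ 2 - m * d ^ 2)) = 0 := by
    linear_combination (a ^ 2 + m * b ^ 2 + n * (c ^ 2 + m * d ^ 2)) * h1 -
      2 * m * (a * b + n * c * d) * h2
  have hm0 : (m : ℚ) ≠ 0 := Int.cast_ne_zero.2 B.squarefree.ne_zero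
  rcases mul_eq_zero.1 h3 with h4 | h4
  · obtain ⟨ha, hc⟩ := Rat.eq_zero_of_sq_eq_mul_sq (Or.inl hn) (a := a) (b := c) (by
      linear_combination h1 / 2 + h4 / 2)
    obtain ⟨hb, hd⟩ := Rat.eq_zero_of_sq_eq_mul_sq (Or.inl hn) (a := b) (b := d)
      (mul_left_cancel₀ hm0 (by linear_combination h1 / 2 - h4 / 2))
    exact ⟨ha, hb, hc, hd⟩
  · obtain ⟨ha, hd⟩ := Rat.eq_zero_of_sq_eq_mul_sq (Or.inl hmn) (a := a) (b := d) (by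
      push_cast
      linear_combination h1 / 2 + h4 / 2)
    obtain ⟨hb, hc⟩ := Rat.eq_zero_of_sq_eq_mul_sq (Or.inl hmn) (a := m * b) (b := c) (by
      push_cast
      linear_combination m * h1 / 2 - m * h4 / 2)
    exact ⟨ha, (mul_eq_zero.1 hb).resolve_left hm0, hc, hd⟩

theorem linearIndependent (B : IsBiquadraticTwo m n P N) :
    LinearIndependent ℚ ![1, P, N, P * N] := by
  rw [Fintype.linearIndependent_iff]
  intro g hg
  simp only [Fin.sum_univ_four, Matrix.cons_val_zero, Matrix.cons_val_one, Matrix.cons_val,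
    Rat.smul_def, mul_one] at hg
  obtain ⟨h0, h1, h2, h3⟩ := B.eq_zero_of_sum_eq_zero hg
  intro i
  fin_cases i <;> assumption

theorem algEquiv_ext (B : IsBiquadraticTwo m n P N) {σ τ : L ≃ₐ[ℚ] L} (hP : σ P = τ P)
    (hN : σ N = τ N) : σ = τ := by
  ext x
  have hx : x ∈ IntermediateField.adjoin ℚ {P, N} := B.adjoin_eq ▸ IntermediateField.mem_top
  induction hx using IntermediateField.adjoin_induction with
  | mem x hx =>
    rcases hx with rfl | rfl
    · exact hP
    · exact hN
  | algebraMap x => simp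
  | add x y _ _ hx hy => rw [map_add, map_add, hx, hy]
  | inv x _ hx => rw [map_inv₀, map_inv₀, hx]
  | mul x y _ _ hx hy => rw [map_mul, map_mul, hx, hy]

theorem map_left (B : IsBiquadraticTwo m n P N) (σ : L ≃ₐ[ℚ] L) : σ P = P ∨ σ P = -P := by
  rw [← sq_eq_sq_iff_eq_or_eq_neg, ← map_pow, B.sq_left, map_intCast]

theorem map_right (B : IsBiquadraticTwo m n P N) (σ : L ≃ₐ[ℚ] L) : σ N = N ∨ σ N = -N := by
  rw [← sq_eq_sq_iff_eq_or_eq_neg, ← map_pow, B.sq_right, map_intCast]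

theorem isGalois (B : IsBiquadraticTwo m n P N) : IsGalois ℚ L := by
  have hs : ∀ (R : L) (D : ℤ), R ^ 2 = D →
      IsIntegral ℚ R ∧ ((minpoly ℚ R).map (algebraMap ℚ L)).Splits := by
    intro R D hR
    refine ⟨Algebra.IsIntegral.isIntegral R, ?_⟩
    have hdvd : minpoly ℚ R ∣ Polynomial.X ^ 2 - Polynomial.C (D : ℚ) :=
      minpoly.dvd _ _ (by simp [hR])
    have he : (Polynomial.X ^ 2 - Polynomial.C (D : ℚ)).map (algebraMap ℚ L) =
        (Polynomial.X - Polynomial.C R) * (Polynomial.X + Polynomial.C R) := by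
      have : (Polynomial.C R) ^ 2 = Polynomial.C (D : L) := by rw [← hR, map_pow]
      rw [Polynomial.map_sub, Polynomial.map_pow, Polynomial.map_X, Polynomial.map_C]
      rw [eq_ratCast, Rat.cast_intCast, ← this]
      ring
    refine Polynomial.Splits.of_dvd ?_ ?_ (Polynomial.map_dvd _ hdvd)
    · rw [he]
      exact (Polynomial.Splits.X_sub_C R).mul (Polynomial.Splits.X_add_C R)
    · rw [he]
      exact mul_ne_zero (Polynomial.X_sub_C_ne_zero R) (Polynomial.X_add_C_ne_zero R)
  have : Normal ℚ L := by
    refine ⟨fun x => ?_⟩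
    refine IntermediateField.splits_of_mem_adjoin ℚ L (S := {P, N}) ?_
      (by rw [B.adjoin_eq]; exact IntermediateField.mem_top)
    rintro x (rfl | rfl)
    · exact hs _ _ B.sq_left
    · exact hs _ _ B.sq_right
  exact ⟨⟩

theorem left_ne_zero (B : IsBiquadraticTwo m n P N) : P ≠ 0 := by
  rintro rfl
  have := B.sq_left
  have h := B.squarefree.ne_zero
  rw [zero_pow two_ne_zero] at this
  exact h (by exact_mod_cast this.symm)

theorem right_ne_zero (B : IsBiquadraticTwo m n P N) : N ≠ 0 := by
  rintro rfl
  have := B.sq_right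
  have h := B.squarefree_right.ne_zero
  rw [zero_pow two_ne_zero] at this
  exact h (by exact_mod_cast this.symm)

open Classical in
-- Signs on the two generators determine an automorphism; the four independent elements `1, P, N, P
-- * N` give at least four automorphisms.
theorem bijective_signs (B : IsBiquadraticTwo m n P N) :
    Function.Bijective (fun σ : L ≃ₐ[ℚ] L => (decide (σ P = P), decide (σ N = N))) := by
  have := B.isGalois
  have hinj : Function.Injective
      (fun σ : L ≃ₐ[ℚ] L => (decide (σ P = P), decide (σ N = N))) := by
    intro σ τ h
    simp only [Prod.mk.injEq, decide_eq_decide] at h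
    refine B.algEquiv_ext ?_ ?_
    · rcases B.map_left σ with h1 | h1 <;> rcases B.map_left τ with h2 | h2
      · rw [h1, h2]
      · rw [h1, h.1.1 h1]
      · rw [h2, h.1.2 h2]
      · rw [h1, h2]
    · rcases B.map_right σ with h1 | h1 <;> rcases B.map_right τ with h2 | h2
      · rw [h1, h2]
      · rw [h1, h.2.1 h1]
      · rw [h2, h.2.2 h2]
      · rw [h1, h2]
  refine (Fintype.bijective_iff_injective_and_card _).2 ⟨hinj, le_antisymm
    (Fintype.card_le_of_injective _ hinj) ?_⟩
  rw [← Nat.card_eq_fintype_card (α := L ≃ₐ[ℚ] L), IsGalois.card_aut_eq_finrank]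
  exact B.linearIndependent.fintype_card_le_finrank

theorem card_eq (B : IsBiquadraticTwo m n P N) : Nat.card (L ≃ₐ[ℚ] L) = 4 := by
  rw [Nat.card_congr (Equiv.ofBijective _ B.bijective_signs)]
  simp

theorem isKleinFour (B : IsBiquadraticTwo m n P N) : IsKleinFour (L ≃ₐ[ℚ] L) where
  card_four := B.card_eq
  exponent_two := by
    have hd : Monoid.exponent (L ≃ₐ[ℚ] L) ∣ 2 := by
      refine Monoid.exponent_dvd_of_forall_pow_eq_one fun σ => ?_
      rw [pow_two]
      refine B.algEquiv_ext ?_ ?_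
      · rcases B.map_left σ with h | h <;> simp [AlgEquiv.mul_apply, h]
      · rcases B.map_right σ with h | h <;> simp [AlgEquiv.mul_apply, h]
    refine ((Nat.dvd_prime Nat.prime_two).1 hd).resolve_left fun h => ?_
    have : Subsingleton (L ≃ₐ[ℚ] L) := Monoid.exp_eq_one_iff.1 h
    have h1 := Nat.card_of_subsingleton (1 : L ≃ₐ[ℚ] L)
    rw [B.card_eq] at h1
    omega

theorem exists_algEquiv (B : IsBiquadraticTwo m n P N) :
    ∃ s t : L ≃ₐ[ℚ] L, s P = P ∧ s N = -N ∧ t P = -P ∧ t N = N := by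
  classical
  obtain ⟨s, hs⟩ := B.bijective_signs.2 (true, false)
  obtain ⟨t, ht⟩ := B.bijective_signs.2 (false, true)
  simp only [Prod.mk.injEq, decide_eq_true_eq, decide_eq_false_iff_not] at hs ht
  exact ⟨s, t, hs.1, (B.map_right s).resolve_left hs.2, (B.map_left t).resolve_left ht.1, ht.2⟩

theorem exists_coordinates (B : IsBiquadraticTwo m n P N) (x : L) :
    ∃ a b c d : ℚ, x = a + b * P + c * N + d * (P * N) := by
  have := B.isGalois
  let b := basisOfLinearIndependentOfCardEqFinrank B.linearIndependent (by
    rw [← IsGalois.card_aut_eq_finrank, B.card_eq]; rfl)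
  refine ⟨b.repr x 0, b.repr x 1, b.repr x 2, b.repr x 3, ?_⟩
  conv_lhs => rw [← b.sum_repr x]
  simp [Fin.sum_univ_four, b, Rat.smul_def]

/-- The coordinates of an algebraic integer of `L`. -/
theorem exists_int_coordinates (B : IsBiquadraticTwo m n P N) {x : L} (hx : IsIntegral ℤ x) :
    ∃ x₀ x₁ x₂ x₃ : ℤ, x = x₀ + x₁ * P + x₂ * N + x₃ * ((N + P * N) / 2) := by
  obtain ⟨s, t, hsP, hsN, htP, htN⟩ := B.exists_algEquiv
  obtain ⟨a, b, c, d, rfl⟩ := B.exists_coordinates x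
  set x := (a : L) + b * P + c * N + d * (P * N) with hx'
  have hm := B.emod
  have hn := B.emod_right
  have hmn := B.emod_mul
  have hs : s x = a + b * P - c * N - d * (P * N) := by
    simp only [hx', map_add, map_mul, map_ratCast, hsP, hsN]; ring
  have ht : t x = a - b * P + c * N - d * (P * N) := by
    simp only [hx', map_add, map_mul, map_ratCast, htP, htN]; ring
  have hst : t (s x) = a - b * P - c * N + d * (P * N) := by
    rw [hs]
    simp only [map_add, map_sub, map_mul, map_ratCast, htP, htN]; ring
  have is : IsIntegral ℤ (s x) := hx.map (s.restrictScalars ℤ)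
  have it : IsIntegral ℤ (t x) := hx.map (t.restrictScalars ℤ)
  have ist : IsIntegral ℤ (t (s x)) := is.map (t.restrictScalars ℤ)
  -- Traces to the three quadratic subfields show that the doubled coordinates are integers.
  obtain ⟨A, Bb, hA, hB⟩ := exists_int_of_isIntegral_quadratic (Or.inr hm) B.squarefree B.sq_left
    (a := 2 * a) (b := 2 * b) ((hx.add is).of_eq (by rw [hs]; push_cast; ring))
    ((it.add ist).of_eq (by rw [hst, ht]; push_cast; ring))
  obtain ⟨_, C, _, hC⟩ := exists_int_of_isIntegral_quadratic (Or.inl hn) B.squarefree_right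
    B.sq_right (a := 2 * a) (b := 2 * c) ((hx.add it).of_eq (by rw [ht]; push_cast; ring))
    ((is.add ist).of_eq (by rw [hst, hs]; push_cast; ring))
  obtain ⟨_, D, _, hD⟩ := exists_int_of_isIntegral_quadratic (Or.inl hmn) B.squarefree_mul
    B.sq_mul (a := 2 * a) (b := 2 * d) ((hx.add ist).of_eq (by rw [hst]; push_cast; ring))
    ((is.add it).of_eq (by rw [hs, ht]; push_cast; ring))
  -- The relative norm `x * s x` to `ℚ(√m)` supplies the remaining congruences: first `A` and `Bb`
  -- are even, then `C` and `D` have equal parity.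
  obtain ⟨p, q, hp, hq⟩ := exists_int_of_isIntegral_quadratic (Or.inr hm) B.squarefree B.sq_left
    (a := a ^ 2 + m * b ^ 2 - n * c ^ 2 - n * m * d ^ 2) (b := 2 * a * b - 2 * n * c * d)
    ((hx.mul is).of_eq (by
      rw [hs]; push_cast; rw [← B.sq_left, ← B.sq_right]; ring))
    ((it.mul ist).of_eq (by
      rw [hst, ht]; push_cast; rw [← B.sq_left, ← B.sq_right]; ring))
  have e1 : A ^ 2 + m * Bb ^ 2 - n * C ^ 2 - n * m * D ^ 2 = 4 * p := by
    have : (A : ℚ) ^ 2 + m * Bb ^ 2 - n * C ^ 2 - n * m * D ^ 2 = 4 * p := by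
      rw [hA, hB, hC, hD, hp]; ring
    exact_mod_cast this
  have e2 : A * Bb - n * C * D = 2 * q := by
    have : (A : ℚ) * Bb - n * C * D = 2 * q := by
      rw [hA, hB, hC, hD, hq]; ring
    exact_mod_cast this
  obtain ⟨n', hn'⟩ : ∃ n', n = 2 * n' := ⟨n / 2, by omega⟩
  have hn'2 : n' % 2 = 1 := by omega
  obtain ⟨m', hm'⟩ : ∃ m', m = 4 * m' + 3 := ⟨m / 4, by omega⟩
  have hA4 := Int.sq_emod_four A
  have hB4 := Int.sq_emod_four Bb
  have hC4 := Int.sq_emod_four C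
  have hD4 := Int.sq_emod_four D
  have hAB : A % 2 = 0 ∧ Bb % 2 = 0 := by
    have f1 : A ^ 2 + 3 * Bb ^ 2 = 2 * (2 * p + n' * C ^ 2 + n' * m * D ^ 2 - 2 * m' * Bb ^ 2) := by
      rw [hn', hm'] at e1
      rw [hm']
      linear_combination e1
    have f2 : A * Bb = 2 * (q + n' * C * D) := by
      rw [hn'] at e2
      linear_combination e2
    have f3 : A * Bb % 2 = (A % 2) * (Bb % 2) % 2 := Int.mul_emod _ _ _
    rcases hA4 with ⟨a1, a2⟩ | ⟨a1, a2⟩ <;> rcases hB4 with ⟨b1, b2⟩ | ⟨b1, b2⟩ <;>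
      rw [a2, b2] at f3 <;> omega
  obtain ⟨A', hA'⟩ := Int.dvd_of_emod_eq_zero hAB.1
  obtain ⟨B', hB'⟩ := Int.dvd_of_emod_eq_zero hAB.2
  have hCD : (C - D) % 2 = 0 := by
    obtain ⟨w, hw⟩ : ∃ w, n' = 2 * w + 1 := ⟨n' / 2, by omega⟩
    have f1 : C ^ 2 + 3 * D ^ 2 = 2 * (A' ^ 2 + m * B' ^ 2 - p - w * (C ^ 2 + m * D ^ 2) -
        2 * m' * D ^ 2) := by
      refine mul_left_cancel₀ (two_ne_zero (α := ℤ)) ?_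
      rw [hn', hA', hB', hw] at e1
      rw [hm'] at e1 ⊢
      linear_combination -e1
    rcases hC4 with ⟨a1, a2⟩ | ⟨a1, a2⟩ <;> rcases hD4 with ⟨b1, b2⟩ | ⟨b1, b2⟩ <;> omega
  obtain ⟨E, hE⟩ := Int.dvd_of_emod_eq_zero hCD
  refine ⟨A', B', E, D, ?_⟩
  have ha : a = A' := by rw [hA'] at hA; push_cast at hA; linarith
  have hb : b = B' := by rw [hB'] at hB; push_cast at hB; linarith
  have hc : c = E + D / 2 := by
    have : C = 2 * E + D := by omega
    rw [this] at hC; push_cast at hC; linarith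
  have hd : d = D / 2 := by linarith
  rw [hx', ha, hb, hc, hd]
  push_cast
  ring

theorem isIntegral_left (B : IsBiquadraticTwo m n P N) : IsIntegral ℤ P :=
  IsIntegral.of_pow two_pos (B.sq_left ▸ isIntegral_algebraMap (A := L) (x := m))

theorem isIntegral_right (B : IsBiquadraticTwo m n P N) : IsIntegral ℤ N :=
  IsIntegral.of_pow two_pos (B.sq_right ▸ isIntegral_algebraMap (A := L) (x := n))

theorem isIntegral_half (B : IsBiquadraticTwo m n P N) : IsIntegral ℤ ((N + P * N) / 2) := by
  have hm := B.emod
  obtain ⟨m', hm'⟩ : ∃ m', m = 2 * m' - 1 := ⟨(m + 1) / 2, by omega⟩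
  obtain ⟨n', hn'⟩ : ∃ n', n = 2 * n' := ⟨n / 2, by have := B.emod_right; omega⟩
  refine IsIntegral.of_pow two_pos ?_
  have : ((N + P * N) / 2) ^ 2 = ((n' : ℤ) : L) * ((m' : ℤ) + P) := by
    have h1 := B.sq_left
    have h2 := B.sq_right
    rw [hm'] at h1
    rw [hn'] at h2
    push_cast at h1 h2
    linear_combination (1 + P) ^ 2 / 4 * h2 + n' / 2 * h1
  rw [this]
  exact (isIntegral_algebraMap (A := L) (x := n')).mul
    ((isIntegral_algebraMap (A := L) (x := m')).add B.isIntegral_left)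

theorem isIntegral_of_int_coordinates (B : IsBiquadraticTwo m n P N) (x₀ x₁ x₂ x₃ : ℤ) :
    IsIntegral ℤ ((x₀ : L) + x₁ * P + x₂ * N + x₃ * ((N + P * N) / 2)) := by
  have h : ∀ z : ℤ, IsIntegral ℤ (z : L) := fun z => isIntegral_algebraMap (A := L) (x := z)
  exact (((h _).add ((h _).mul B.isIntegral_left)).add ((h _).mul B.isIntegral_right)).add
    ((h _).mul B.isIntegral_half)

end IsBiquadraticTwo

/-! ### Explicit free generators. -/

theorem HopfGaloisStructure.free_of_exists_act_eq {L H : Type*} [Field L] [NumberField L] [Ring H]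
    [HopfAlgebra ℚ H] (S : HopfGaloisStructure ℚ L H) {α : L} (hα : IsIntegral ℤ α)
    (hS : ∀ x, IsIntegral ℤ x → ∃ h : H, (∀ y, IsIntegral ℤ y → IsIntegral ℤ (S.act h y)) ∧
      S.act h α = x) : Module.Free S.associatedOrder (𝓞 L) := by
  have := S.finite
  let φ : H →ₗ[ℚ] L := S.act.toLinearMap.flip α
  have hφ : ∀ h, φ h = S.act h α := fun h => rfl
  -- Clearing denominators extends surjectivity from `𝓞 L` to `L`; equal dimensions then give
  -- injectivity.
  have hsurj : Function.Surjective φ := by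
    intro x
    obtain ⟨d, hd, hx⟩ := IsAlgebraic.exists_integral_multiple
      ((IsFractionRing.isAlgebraic_iff ℤ ℚ L).2 (Algebra.IsAlgebraic.isAlgebraic (R := ℚ) x))
    obtain ⟨h, -, hh⟩ := hS _ hx
    refine ⟨(d : ℚ)⁻¹ • h, ?_⟩
    rw [map_smul, hφ, hh, zsmul_eq_mul, Rat.smul_def]
    have : (d : L) ≠ 0 := Int.cast_ne_zero.2 hd
    push_cast
    field_simp
  have hinj : Function.Injective φ :=
    (LinearMap.injective_iff_surjective_of_finrank_eq_finrank S.finrank_eq).2 hsurj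
  let f : S.associatedOrder →ₗ[S.associatedOrder] 𝓞 L :=
    LinearMap.toSpanSingleton S.associatedOrder (𝓞 L) ⟨α, hα⟩
  have hf : ∀ h, ((f h : 𝓞 L) : L) = S.act (h : H) α := fun h => S.coe_smul h ⟨α, hα⟩
  refine Module.Free.of_equiv (LinearEquiv.ofBijective f ⟨fun a b e => ?_, fun x => ?_⟩)
  · refine Subtype.ext (hinj ?_)
    rw [hφ, hφ, ← hf, ← hf, e]
  · obtain ⟨h, hh, hx⟩ := hS x x.2
    exact ⟨⟨h, hh⟩, Subtype.ext ((hf _).trans hx)⟩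

namespace IsBiquadraticTwo

variable {L : Type*} [Field L] [NumberField L] {m n : ℤ} {P N : L}

theorem isIntegral_map (B : IsBiquadraticTwo m n P N) (f : Module.End ℚ L)
    (h1 : ∃ x₀ x₁ x₂ x₃ : ℤ, f 1 = x₀ + x₁ * P + x₂ * N + x₃ * ((N + P * N) / 2))
    (hP : ∃ x₀ x₁ x₂ x₃ : ℤ, f P = x₀ + x₁ * P + x₂ * N + x₃ * ((N + P * N) / 2))
    (hN : ∃ x₀ x₁ x₂ x₃ : ℤ, f N = x₀ + x₁ * P + x₂ * N + x₃ * ((N + P * N) / 2))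
    (hK : ∃ x₀ x₁ x₂ x₃ : ℤ, f ((N + P * N) / 2) =
      x₀ + x₁ * P + x₂ * N + x₃ * ((N + P * N) / 2)) (y : L) (hy : IsIntegral ℤ y) :
    IsIntegral ℤ (f y) := by
  have hint : ∀ z, (∃ x₀ x₁ x₂ x₃ : ℤ, z = x₀ + x₁ * P + x₂ * N + x₃ * ((N + P * N) / 2)) →
      IsIntegral ℤ z := by
    rintro _ ⟨x₀, x₁, x₂, x₃, rfl⟩
    exact B.isIntegral_of_int_coordinates x₀ x₁ x₂ x₃
  have hz : ∀ z : ℤ, IsIntegral ℤ (z : L) := fun z => isIntegral_algebraMap (A := L) (x := z)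
  obtain ⟨x₀, x₁, x₂, x₃, rfl⟩ := B.exists_int_coordinates hy
  have hf : ∀ (z : ℤ) (w : L), f (z * w) = z * f w := fun z w => by
    rw [← zsmul_eq_mul, map_zsmul, zsmul_eq_mul]
  rw [map_add, map_add, map_add, hf, hf, hf, ← mul_one (x₀ : L), hf]
  exact ((((hz _).mul (hint _ h1)).add ((hz _).mul (hint _ hP))).add
    ((hz _).mul (hint _ hN))).add ((hz _).mul (hint _ hK))

theorem isIntegral_one_add_half (B : IsBiquadraticTwo m n P N) :
    IsIntegral ℤ (1 + (N + P * N) / 2) :=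
  isIntegral_one.add B.isIntegral_half

theorem free_associatedOrder (B : IsBiquadraticTwo m n P N) {H : Type*} [Ring H]
    [HopfAlgebra ℚ H] (S : HopfGaloisStructure ℚ L H) : Module.Free S.associatedOrder (𝓞 L) := by
  have := B.isGalois
  have := B.isKleinFour
  obtain ⟨s, t, hsP, hsN, htP, htN⟩ := B.exists_algEquiv
  have hP0 : P ≠ -P := fun e => B.left_ne_zero (self_eq_neg.1 e)
  have hN0 : N ≠ -N := fun e => B.right_ne_zero (self_eq_neg.1 e)
  have hs1 : s ≠ 1 := by rintro rfl; exact hN0 hsN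
  have ht1 : t ≠ 1 := by rintro rfl; exact hP0 htP
  have hP2 := B.sq_left
  have hN2 := B.sq_right
  rcases S.exists_act with h | ⟨r, hr, h⟩
  · refine S.free_of_exists_act_eq ((isIntegral_one.add B.isIntegral_left).add B.isIntegral_half)
      fun x hx => ?_
    obtain ⟨x₀, x₁, x₂, x₃, rfl⟩ := B.exists_int_coordinates hx
    have hts : t ≠ s := by rintro rfl; exact hP0 (hsP.symm.trans htP)
    -- Fourier inversion: `g` has eigenvalues `x₀, x₁, 2 * x₂ + x₃, x₃` on `1, P, N, P * N`.
    obtain ⟨g, hg⟩ := h s t hs1 ht1 hts ((x₀ + x₁ + (2 * x₂ + x₃) + x₃) / 4)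
      ((x₀ + x₁ - (2 * x₂ + x₃) - x₃) / 4) ((x₀ - x₁ + (2 * x₂ + x₃) - x₃) / 4)
      ((x₀ - x₁ - (2 * x₂ + x₃) + x₃) / 4)
    simp only [eq_ratCast] at hg
    refine ⟨g, B.isIntegral_map _ ⟨x₀, 0, 0, 0, ?_⟩ ⟨0, x₁, 0, 0, ?_⟩ ⟨0, 0, 2 * x₂ + x₃, 0, ?_⟩
      ⟨0, 0, x₂, x₃, ?_⟩, ?_⟩ <;> rw [hg] <;>
      simp only [map_add, map_mul, map_div₀, map_neg, map_one, map_ofNat, hsP, hsN, htP, htN] <;>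
      push_cast <;> ring
  · have hcases : (r P = P ∧ r N = -N) ∨ (r P = -P ∧ r N = N) ∨ (r P = -P ∧ r N = -N) := by
      rcases B.map_left r with h1 | h1 <;> rcases B.map_right r with h2 | h2
      · exact absurd (B.algEquiv_ext (τ := 1) h1 h2) hr
      all_goals simp [h1, h2]
    have hε : ∃ ε : ℤ, n = 2 * ε ∧ ε * ε = 1 := by
      rcases B.eq_two_or with rfl | rfl
      · exact ⟨1, rfl, rfl⟩
      · exact ⟨-1, rfl, rfl⟩
    obtain ⟨ε, hn, hε⟩ := hε
    have hεL : (ε : L) * ε = 1 := by exact_mod_cast hε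
    rw [hn] at hN2
    push_cast at hN2
    rcases hcases with ⟨hrP, hrN⟩ | ⟨hrP, hrN⟩ | ⟨hrP, hrN⟩
    · refine S.free_of_exists_act_eq
        ((isIntegral_one.add B.isIntegral_left).add B.isIntegral_right) fun x hx => ?_
      obtain ⟨x₀, x₁, x₂, x₃, rfl⟩ := B.exists_int_coordinates hx
      have htr : t ≠ r := by rintro rfl; exact hP0 (hrP.symm.trans htP)
      -- Such an element acts as `a + b + 2 c p` where `r = 1` and as `a - b + 2 z p` where `r =
      -- -1`. Here it has eigenvalues `x₀, x₁` on `1, P` and multiplies `N` by `x₂ + x₃ (1 + P) /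
      -- 2`. Stability of `𝓞 L` needs `4 ∣ m + 1`.
      obtain ⟨g, hg⟩ := h t ht1 htr ((x₀ + x₁ + (2 * x₂ + x₃)) / 4)
        ((x₀ + x₁ - (2 * x₂ + x₃)) / 4) ((x₀ - x₁) / 4) (x₃ / 4 * P)
        (by simp [hrP, map_ofNat r]) (by simp [htP, map_ofNat t])
      simp only [eq_ratCast] at hg
      obtain ⟨m', hm'⟩ : ∃ m', m = 4 * m' + 3 := ⟨m / 4, by have := B.emod; omega⟩
      rw [hm'] at hP2
      push_cast at hP2
      refine ⟨g, B.isIntegral_map _ ⟨x₀, 0, 0, 0, ?_⟩ ⟨0, x₁, 0, 0, ?_⟩ ⟨0, 0, x₂, x₃, ?_⟩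
        ⟨0, 0, -x₃ * (m' + 1), x₂ + x₃, ?_⟩, ?_⟩ <;> rw [hg] <;>
        simp only [map_add, map_mul, map_div₀, map_neg, map_one, map_ofNat, hrP, hrN, htP, htN] <;>
        push_cast
      · ring
      · ring
      · ring
      · linear_combination - x₃ * N / 4 * hP2
      · ring
    · refine S.free_of_exists_act_eq B.isIntegral_one_add_half fun x hx => ?_
      obtain ⟨x₀, x₁, x₂, x₃, rfl⟩ := B.exists_int_coordinates hx
      have hsr : s ≠ r := by rintro rfl; exact hP0 (hsP.symm.trans hrP)
      -- Eigenvalues `x₀, 2 * x₂ + x₃` on `1, N`. The choice `z = -(x₁ / n) N` sends `P * N / 2` to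
      -- `x₁ P + x₃ P N / 2`; then `P` acquires the term `-(2 x₁ / n) P N`, which is integral
      -- because `2 / n = ε`.
      obtain ⟨g, hg⟩ := h s hs1 hsr ((x₀ + (2 * x₂ + x₃) + 2 * x₃) / 4)
        ((x₀ + (2 * x₂ + x₃) - 2 * x₃) / 4) ((x₀ - (2 * x₂ + x₃)) / 4) (- ε * x₁ / 2 * N)
        (by simp [hrN, map_ofNat r]) (by simp [hsN, map_ofNat s])
      simp only [eq_ratCast] at hg
      refine ⟨g, B.isIntegral_map _ ⟨x₀, 0, 0, 0, ?_⟩ ⟨0, x₃, ε * x₁, -2 * ε * x₁, ?_⟩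
        ⟨0, 0, 2 * x₂ + x₃, 0, ?_⟩ ⟨0, x₁, x₂, x₃, ?_⟩, ?_⟩ <;> rw [hg] <;>
        simp only [map_add, map_mul, map_div₀, map_neg, map_one, map_ofNat, hrP, hrN, hsP, hsN] <;>
        push_cast
      · ring
      · ring
      · ring
      · linear_combination ε * x₁ * P / 2 * hN2 + x₁ * P * hεL
      · linear_combination ε * x₁ * P / 2 * hN2 + x₁ * P * hεL
    · refine S.free_of_exists_act_eq B.isIntegral_one_add_half fun x hx => ?_
      obtain ⟨x₀, x₁, x₂, x₃, rfl⟩ := B.exists_int_coordinates hx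
      have hsr : s ≠ r := by rintro rfl; exact hP0 (hsP.symm.trans hrP)
      -- Now `P * N` is fixed by `r`: eigenvalues `x₀, x₃` on `1, P * N`, and `z` makes `N / 2`
      -- contribute `x₁ P`, again using `2 / n = ε`.
      obtain ⟨g, hg⟩ := h s hs1 hsr ((x₀ + x₃ + 2 * (2 * x₂ + x₃)) / 4)
        ((x₀ + x₃ - 2 * (2 * x₂ + x₃)) / 4) ((x₀ - x₃) / 4) (- ε * x₁ / 2 * (P * N))
        (by simp [hrP, hrN, map_ofNat r]) (by simp [hsP, hsN, map_ofNat s])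
      simp only [eq_ratCast] at hg
      refine ⟨g, B.isIntegral_map _ ⟨x₀, 0, 0, 0, ?_⟩ ⟨0, 2 * x₂ + x₃, - ε * x₁ * m, 0, ?_⟩
        ⟨0, 2 * x₁, 2 * x₂ + x₃, 0, ?_⟩ ⟨0, x₁, x₂, x₃, ?_⟩, ?_⟩ <;> rw [hg] <;>
        simp only [map_add, map_mul, map_div₀, map_neg, map_one, map_ofNat, hrP, hrN, hsP, hsN] <;>
        push_cast
      · ring
      · linear_combination - ε * x₁ * N * hP2
      · linear_combination ε * x₁ * P * hN2 + 2 * x₁ * P * hεL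
      · linear_combination ε * x₁ * P / 2 * hN2 + x₁ * P * hεL
      · linear_combination ε * x₁ * P / 2 * hN2 + x₁ * P * hεL

end IsBiquadraticTwo

/-! ### Reduction of `k = ±2` to `n = ±2`. -/

theorem eq_mul_of_mul_div_gcd_sq {m n k : ℤ} (hm : m % 2 = 1)
    (hk : k = m * n / (Int.gcd m n : ℤ) ^ 2) (h : k = 2 ∨ k = -2) : n = m * k := by
  have hg : (Int.gcd m n : ℤ) ≠ 0 := by
    intro h0
    rw [Int.natCast_eq_zero, Int.gcd_eq_zero_iff] at h0
    omega
  obtain ⟨m', hm'⟩ := Int.gcd_dvd_left (a := m) (b := n)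
  obtain ⟨n', hn'⟩ := Int.gcd_dvd_right (a := m) (b := n)
  set g : ℤ := (Int.gcd m n : ℤ)
  have hk' : k = m' * n' := by
    rw [hk, show m * n = m' * n' * g ^ 2 by rw [hm', hn']; ring]
    exact Int.mul_ediv_cancel _ (pow_ne_zero 2 hg)
  have hodd : m' % 2 = 1 := by
    rcases Int.emod_two_eq_zero_or_one m' with e | e
    · rw [hm', Int.mul_emod, e] at hm
      simp at hm
    · exact e
  have hdvd : m' ∣ 2 := by
    rcases h with h | h
    · exact ⟨n', by rw [← hk', h]⟩
    · exact ⟨-n', by rw [mul_neg, ← hk', h]; rfl⟩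
  -- The cofactor `m'` of the gcd is odd and divides `2`, so it is a unit and `m ∣ n`.
  have hsq : m' * m' = 1 := by
    have h1 := Int.le_of_dvd two_pos hdvd
    have h2 := Int.le_of_dvd two_pos ((neg_dvd).2 hdvd)
    have : m' = 1 ∨ m' = -1 := by omega
    rcases this with e | e <;> rw [e] <;> rfl
  rw [hk', hm']
  linear_combination hn' - g * n' * hsq

theorem mainTheorem5 {L : Type*} [Field L] [NumberField L]
    (m n k : ℤ) (hm : Squarefree m) (hn : Squarefree n)
    (hm4 : m ≡ 3 [ZMOD 4]) (hn4 : n ≡ 2 [ZMOD 4])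
    (hk : k = m * n / (Int.gcd m n : ℤ) ^ 2)
    (sqrt_m sqrt_n : L) (hsm : sqrt_m ^ 2 = (m : L)) (hsn : sqrt_n ^ 2 = (n : L))
    (hL : IntermediateField.adjoin ℚ {sqrt_m, sqrt_n} = (⊤ : IntermediateField ℚ L))
    (h : n = 2 ∨ n = -2 ∨ k = 2 ∨ k = -2)
    {H : Type*} [Ring H] [HopfAlgebra ℚ H] (S : HopfGaloisStructure ℚ L H) :
    Module.Free S.associatedOrder (𝓞 L) := by
  have hm3 : m % 4 = 3 := hm4
  rw [← or_assoc] at h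
  rcases h with h | h
  · exact IsBiquadraticTwo.free_associatedOrder ⟨hm, hm3, h, hsm, hsn, hL⟩ S
  · have hnk := eq_mul_of_mul_div_gcd_sq (by omega) hk h
    have hm0 : (m : L) ≠ 0 := Int.cast_ne_zero.2 hm.ne_zero
    -- Since `n = m * k`, the element `√m √n / m` is a square root of `k`, and with `√m` it
    -- generates the same field.
    refine IsBiquadraticTwo.free_associatedOrder (m := m) (n := k) (P := sqrt_m)
      (N := sqrt_m * sqrt_n / m) ⟨hm, hm3, h, hsm, ?_, ?_⟩ S
    · rw [div_pow, mul_pow, hsm, hsn, hnk]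
      push_cast
      field_simp
    · rw [eq_top_iff, ← hL, IntermediateField.adjoin_le_iff]
      have h1 := IntermediateField.subset_adjoin ℚ {sqrt_m, sqrt_m * sqrt_n / (m : L)}
      have hP : sqrt_m ∈ IntermediateField.adjoin ℚ {sqrt_m, sqrt_m * sqrt_n / (m : L)} :=
        h1 (by simp)
      rintro x (rfl | rfl)
      · exact hP
      · have e : sqrt_m * (sqrt_m * x / m) = x := by
          rw [← mul_div_assoc, ← mul_assoc, ← pow_two, hsm]
          field_simp
        have hx := mul_mem hP (h1 (Or.inr rfl))
        rwa [e] at hx
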